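/- Let $X$ be a reduced proper curve over a field $k$, the union of three smooth irreducible curves $X_1,X_2,X_3$ such that $X_1$ and $X_2$ meet transversally at a $k$-rational point $A$, $X_2$ and $X_3$ meet transversally at a $k$-rational point $B\neq A$, and there are no other intersections. For a union $Y$ of components let $Y^c$ be the closure of $X\setminus Y$. Fix invertible sheaves $\mathcal O_{(X_1)},\mathcal O_{(X_2)},\mathcal O_{(X_3)}$ on $X$ whose restrictions to $(X_1,X_2,X_3)$ are respectively $$(\mathcal O_{X_1}(-A),\ \mathcal O_{X_2}(A),\ \mathcal O_{X_3}),\quad (\mathcal O_{X_1}(A),\ \mathcal O_{X_2}(-A-B),\ \mathcal O_{X_3}(B)),\quad (\mathcal O_{X_1},\ \mathcal O_{X_2}(B),\ \mathcal O_{X_3}(-B)),$$ so that their multidegrees are $m_1=(-1,1,0)$, $m_2=(1,-2,1)$, $m_3=(0,1,-1)$. Fix integers $d,r$, and let $\mathcal L$ be an invertible sheaf on $X$ of degree $d$ on $X_1$ and degree $0$ on $X_2$ and $X_3$. For each nonnegative multidegree $\underline d=(i,d-i-l,l)$ put $$\mathcal L_{\underline d}=\mathcal L\otimes\mathcal O_{(X_1)}^{\otimes(d-i)}\otimes(\mathcal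 O_{(X_1)}\otimes\mathcal O_{(X_2)})^{\otimes l}.$$ Fix linking maps $\varphi_{\underline d,\underline d'}:\mathcal L_{\underline d}\to\mathcal L_{\underline d'}$ and $\varphi_{\underline d',\underline d}:\mathcal L_{\underline d'}\to\mathcal L_{\underline d}$, for all nonnegative multidegrees $\underline d$ and $\underline d'=\underline d+m_q$, such that 1. $\varphi_{\underline d,\underline d'}$ factors as $\mathcal L_{\underline d}\to\mathcal L_{\underline d}|_{X_q^c}\cong\mathcal L_{\underline d'}|_{X_q^c}(-X_q\cap X_q^c)\hookrightarrow\mathcal L_{\underline d'}$, where the first map is the restriction and the last one is the inclusion of the sections vanishing on $X_q$; 2. $\varphi_{\underline d',\underline d}$ factors as $\mathcal L_{\underline d'}\to\mathcal L_{\underline d'}|_{X_q}\cong\mathcal L_{\underline d}|_{X_q}(-X_q\cap X_q^c)\hookrightarrow\mathcal L_{\underline d}$, where the first map is the restriction and the last one is the inclusion of the sections vanishing on $X_q^c$; 3. $\varphi_{\underline d^2,\underline d^3}\circ\varphi_{\underline d^1,\underline d^2}=\varphi_{\underline d^1,\underline d^3}$ whenever $\underline d^2=\underline d^1+m_{q_1}$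 and $\underline d^3=\underline d^2+m_{q_2}$ are nonnegative with $q_1\ne q_2$. For nonnegative $\underline d^0\neq\underline d$, let $\varphi_{\underline d^0,\underline d}$ be the composition of linking maps along any path of nonnegative multidegrees from $\underline d^0$ to $\underline d$, with steps $\pm m_q$, that satisfies none of the following: (I) each of $+m_1,+m_2,+m_3$ occurs as a step; (II) both $+m_q$ and $-m_q$ occur for some $q$; (III) $-m_{q_1}$ and $-m_{q_2}$ occur for some $q_1\neq q_2$. Such paths exist and all give the same composition. Put $\varphi_{\underline d,\underline d}=\mathrm{id}$. A limit linear series of degree $d$ and dimension $r$ on $X$ consists of $\mathcal L$ as above and subspaces $V_{\underline d}\subseteq H^0(X,\mathcal L_{\underline d})$ of dimension $r+1$, one for each nonnegative $\underline d$, that are mapped into each other by the linking maps. It is *simple* if there are multidegrees $\underline d^1,\dots,\underline d^m\ge 0$ of total degree $d$ and, for each $\alpha$, linearly independent sections $s^\alpha_1,\dots,s^\alpha_{r_\alpha}\in V_{\underline d^\alpha}$ such that, for every nonnegative $\underline d$, the family $\big(\varphi_{\underline d^\alpha,\underline d}(s^\alpha_j)\big)_{\alpha,j}$ is a basis of $V_{\underline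 d}$. It is *exact* if, for all nonnegative $\underline d$ and $\underline d'=\underline d+m_q$, $$\varphi_{\underline d,\underline d'}(V_{\underline d})=V_{\underline d'}^{X_q,0}\quad\text{and}\quad\varphi_{\underline d',\underline d}(V_{\underline d'})=V_{\underline d}^{X_q^c,0},$$ where $V^{Y,0}\subseteq V$ is the subspace of the sections vanishing on $Y$. **Proposition.** Every simple limit linear series on $X$ is exact. -/

import Mathlib

open CategoryTheory CategoryTheory.Limits AlgebraicGeometry TopologicalSpace

universe u

noncomputable section

namespace LimitSeries

/-! ### Sheaves of modules on schemes -/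

section Sheaves

/-- The structure sheaf `𝒪_X` as a sheaf of modules. -/
abbrev structureSheaf (X : Scheme.{u}) : X.Modules :=
  SheafOfModules.unit X.ringCatSheaf

/-- The tensor product of two `𝒪_X`-modules: the sheafification of
`U ↦ M(U) ⊗_{𝒪_X(U)} N(U)`. -/
def tensor {X : Scheme.{u}} (M N : X.Modules) : X.Modules :=
  (PresheafOfModules.sheafification (𝟙 X.ringCatSheaf.obj)).obj
    (PresheafOfModules.Monoidal.tensorObj (R := X.presheaf) M.val N.val)

/-- The tensor power `M^{⊗ n}`. -/
def tensorPow {X : Scheme.{u}} (M : X.Modules) : ℕ → X.Modules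
  | 0 => structureSheaf X
  | n + 1 => tensor (tensorPow M n) M

/-- Invertible sheaves: the modules that are locally isomorphic to the structure sheaf. -/
def IsInvertible {X : Scheme.{u}} (M : X.Modules) : Prop :=
  ∀ x : X, ∃ U : X.Opens, x ∈ U ∧
    Nonempty (M.restrict U.ι ≅ structureSheaf (U : Scheme.{u}))

/-- The restriction `M|_D` to the closed subscheme `D` with ideal sheaf `I`, seen as a sheaf on
the ambient scheme (that is, `ι_* ι^* M` for the closed immersion `ι : D ⟶ X`). -/
def restrictTo {X : Scheme.{u}} (I : X.IdealSheafData) (M : X.Modules) : X.Modules :=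
  (Scheme.Modules.pushforward I.subschemeι).obj ((Scheme.Modules.pullback I.subschemeι).obj M)

/-- The restriction map `M ⟶ M|_D`. -/
def restrictionMap {X : Scheme.{u}} (I : X.IdealSheafData) (M : X.Modules) :
    M ⟶ restrictTo I M :=
  (Scheme.Modules.pullbackPushforwardAdjunction I.subschemeι).unit.app M

/-- The subsheaf of `M` of the sections that vanish on the closed subscheme `D` with ideal
sheaf `I`, i.e. the kernel of `M ⟶ M|_D`. -/
def vanishingSubsheaf {X : Scheme.{u}} (I : X.IdealSheafData) (M : X.Modules) : X.Modules :=
  kernel (restrictionMap I M)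

/-- The inclusion of `vanishingSubsheaf I M` in `M`. -/
def vanishingSubsheafι {X : Scheme.{u}} (I : X.IdealSheafData) (M : X.Modules) :
    vanishingSubsheaf I M ⟶ M :=
  kernel.ι (restrictionMap I M)

/-- The ideal sheaf `𝒪_X(-D)` of the closed subscheme `D`, as an `𝒪_X`-module. -/
def idealModule {X : Scheme.{u}} (I : X.IdealSheafData) : X.Modules :=
  vanishingSubsheaf I (structureSheaf X)

/-- `M` and `N` are inverse to each other. For an invertible ideal sheaf `𝒪_X(-D)`, the sheaves
inverse to it are those isomorphic to `𝒪_X(D)`. -/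
def AreInverse {X : Scheme.{u}} (M N : X.Modules) : Prop :=
  Nonempty (tensor M N ≅ structureSheaf X)

end Sheaves

/-! ### Global sections -/

section GlobalSections

variable {k : Type u} [Field k] {X : Scheme.{u}}

/-- The ring homomorphism `k → Γ(X, 𝒪_X)` of a `k`-scheme `f : X ⟶ Spec k`. -/
def scalars (f : X ⟶ Spec (CommRingCat.of k)) : k →+* Γ(X, ⊤) :=
  ((Scheme.ΓSpecIso (CommRingCat.of k)).inv ≫ f.appTop).hom

/-- `H⁰(X, M)`. -/
def H0 (_f : X ⟶ Spec (CommRingCat.of k)) (M : X.Modules) : Type u := Γ(M, ⊤)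

instance (f : X ⟶ Spec (CommRingCat.of k)) (M : X.Modules) : AddCommGroup (H0 f M) :=
  inferInstanceAs (AddCommGroup Γ(M, ⊤))

/-- `H⁰(X, M)` is a vector space over the base field. -/
instance (f : X ⟶ Spec (CommRingCat.of k)) (M : X.Modules) : Module k (H0 f M) :=
  Module.compHom (Γ(M, ⊤) : Type u) (scalars f)

/-- The linear map `H⁰(X, M) → H⁰(X, N)` induced by a morphism of sheaves. -/
def H0.map (f : X ⟶ Spec (CommRingCat.of k)) {M N : X.Modules} (φ : M ⟶ N) :
    H0 f M →ₗ[k] H0 f N where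
  toFun s := (Scheme.Modules.Hom.app φ ⊤).hom s
  map_add' s t := map_add (Scheme.Modules.Hom.app φ ⊤).hom s t
  map_smul' c s := Scheme.Modules.Hom.app_smul φ (scalars f c) s

end GlobalSections

/-! ### Degrees of invertible sheaves on a curve -/

section Degree

variable {k : Type u} [Field k] {C : Scheme.{u}}

/-- `D` is an effective Cartier divisor, finite over the base field. -/
def IsEffectiveDivisor (f : C ⟶ Spec (CommRingCat.of k)) (D : C.IdealSheafData) : Prop :=
  IsInvertible (idealModule D) ∧ IsFinite (D.subschemeι ≫ f)

/-- The degree `dim_k H⁰(D, 𝒪_D)` of an effective divisor. -/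
def divisorDegree (f : C ⟶ Spec (CommRingCat.of k)) (D : C.IdealSheafData) : ℕ :=
  Module.finrank k (H0 (D.subschemeι ≫ f) (structureSheaf D.subscheme))

/-- The invertible sheaf `M` on the smooth proper curve `C` has degree `n`: there are effective
divisors `D`, `E` with `M ≅ 𝒪_C(D - E)`, i.e. `M ⊗ 𝒪_C(-D) ≅ 𝒪_C(-E)`, and
`n = deg D - deg E`. -/
def HasDegree (f : C ⟶ Spec (CommRingCat.of k)) (M : C.Modules) (n : ℤ) : Prop :=
  ∃ D E : C.IdealSheafData, IsEffectiveDivisor f D ∧ IsEffectiveDivisor f E ∧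
    Nonempty (tensor M (idealModule D) ≅ idealModule E) ∧
    n = (divisorDegree f D : ℤ) - (divisorDegree f E : ℤ)

end Degree

/-! ### The curve -/

/-- A reduced proper curve `X` over a field `k` that is the union of three smooth irreducible
curves `X₁, X₂, X₃` (here `comp 0`, `comp 1`, `comp 2`) such that `X₁` and `X₂` meet
transversally at a `k`-rational point `A`, `X₂` and `X₃` meet transversally at a `k`-rational
point `B ≠ A`, and there are no further intersections. -/
structure ThreeComponentCurve (k : Type u) [Field k] where
  /-- the total curve -/
  X : Scheme.{u}
  /-- its structure morphism -/
  str : X ⟶ Spec (CommRingCat.of k)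
  isProper : IsProper str
  isReduced : IsReduced X
  /-- the components, as closed subsets -/
  comp : Fin 3 → Closeds X
  comp_irreducible : ∀ q, IsIrreducible (comp q : Set X)
  comp_cover : (comp 0 : Set X) ∪ comp 1 ∪ comp 2 = Set.univ
  /-- each component, with its reduced structure, is smooth of dimension one over `k` -/
  comp_smooth : ∀ q, SmoothOfRelativeDimension 1
    ((Scheme.IdealSheafData.vanishingIdeal (comp q)).subschemeι ≫ str)
  A : X
  B : X
  A_ne_B : A ≠ B
  isClosed_A : IsClosed ({A} : Set X)
  isClosed_B : IsClosed ({B} : Set X)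
  /-- `A` is rational over `k` -/
  rational_A : IsIso
    ((Scheme.IdealSheafData.vanishingIdeal (⟨{A}, isClosed_A⟩ : Closeds X)).subschemeι ≫ str)
  /-- `B` is rational over `k` -/
  rational_B : IsIso
    ((Scheme.IdealSheafData.vanishingIdeal (⟨{B}, isClosed_B⟩ : Closeds X)).subschemeι ≫ str)
  /-- the scheme-theoretic intersection of `X₁` and `X₂` is the reduced point `A` -/
  transversal_A :
    Scheme.IdealSheafData.vanishingIdeal (comp 0) ⊔ Scheme.IdealSheafData.vanishingIdeal (comp 1)
      = Scheme.IdealSheafData.vanishingIdeal (⟨{A}, isClosed_A⟩ : Closeds X)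
  /-- the scheme-theoretic intersection of `X₂` and `X₃` is the reduced point `B` -/
  transversal_B :
    Scheme.IdealSheafData.vanishingIdeal (comp 1) ⊔ Scheme.IdealSheafData.vanishingIdeal (comp 2)
      = Scheme.IdealSheafData.vanishingIdeal (⟨{B}, isClosed_B⟩ : Closeds X)
  disjoint_ends : Disjoint (comp 0 : Set X) (comp 2 : Set X)

namespace ThreeComponentCurve

variable {k : Type u} [Field k] (C : ThreeComponentCurve k)

/-- The ideal sheaf of a closed subset with its reduced structure. -/
def reducedIdeal (Y : Closeds C.X) : C.X.IdealSheafData :=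
  Scheme.IdealSheafData.vanishingIdeal Y

/-- `Y^c`, the closure of the complement of `Y`. -/
def compl (Y : Closeds C.X) : Closeds C.X := ⟨closure (Y : Set C.X)ᶜ, isClosed_closure⟩

/-- The component `X_q` as a scheme. -/
abbrev component (q : Fin 3) : Scheme.{u} := (C.reducedIdeal (C.comp q)).subscheme

/-- The closed immersion `X_q ⟶ X`. -/
abbrev componentι (q : Fin 3) : C.component q ⟶ C.X := (C.reducedIdeal (C.comp q)).subschemeι

/-- The restriction of a sheaf on `X` to the component `X_q`. -/
abbrev res (q : Fin 3) (M : C.X.Modules) : (C.component q).Modules :=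
  (Scheme.Modules.pullback (C.componentι q)).obj M

/-- The sheaf `𝒪_{X_q}(-A)` on `X_q` (for a component `X_q` through `A`). -/
def minusA (q : Fin 3) : (C.component q).Modules :=
  idealModule ((C.reducedIdeal ⟨{C.A}, C.isClosed_A⟩).comap (C.componentι q))

/-- The sheaf `𝒪_{X_q}(-B)` on `X_q` (for a component `X_q` through `B`). -/
def minusB (q : Fin 3) : (C.component q).Modules :=
  idealModule ((C.reducedIdeal ⟨{C.B}, C.isClosed_B⟩).comap (C.componentι q))

end ThreeComponentCurve

/-- A choice of the invertible sheaves `𝒪_(X₁)`, `𝒪_(X₂)`, `𝒪_(X₃)` on `X`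
(here `T 0`, `T 1`, `T 2`), with the restrictions
* `𝒪_(X₁)`: `𝒪_{X₁}(-A)`, `𝒪_{X₂}(A)`, `𝒪_{X₃}`;
* `𝒪_(X₂)`: `𝒪_{X₁}(A)`, `𝒪_{X₂}(-A-B)`, `𝒪_{X₃}(B)`;
* `𝒪_(X₃)`: `𝒪_{X₁}`, `𝒪_{X₂}(B)`, `𝒪_{X₃}(-B)`. -/
structure TwistingSheaves {k : Type u} [Field k] (C : ThreeComponentCurve k) where
  T : Fin 3 → C.X.Modules
  invertible : ∀ q, IsInvertible (T q)
  res00 : Nonempty (C.res 0 (T 0) ≅ C.minusA 0)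
  res01 : AreInverse (C.res 1 (T 0)) (C.minusA 1)
  res02 : Nonempty (C.res 2 (T 0) ≅ structureSheaf (C.component 2))
  res10 : AreInverse (C.res 0 (T 1)) (C.minusA 0)
  res11 : Nonempty (C.res 1 (T 1) ≅ tensor (C.minusA 1) (C.minusB 1))
  res12 : AreInverse (C.res 2 (T 1)) (C.minusB 2)
  res20 : Nonempty (C.res 0 (T 2) ≅ structureSheaf (C.component 0))
  res21 : AreInverse (C.res 1 (T 2)) (C.minusB 1)
  res22 : Nonempty (C.res 2 (T 2) ≅ C.minusB 2)

/-! ### Multidegrees and paths -/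

/-- The nonnegative multidegrees `(i, d - i - l, l)` of total degree `d`. -/
def Multidegree (d : ℤ) : Type :=
  {v : Fin 3 → ℤ // (∀ q, 0 ≤ v q) ∧ v 0 + v 1 + v 2 = d}

/-- The multidegree of `𝒪_(X_q)`. -/
def twistDegree : Fin 3 → (Fin 3 → ℤ) :=
  ![![-1, 1, 0], ![1, -2, 1], ![0, 1, -1]]

/-- `b = a + multideg 𝒪_(X_q)`. -/
def IsShift {d : ℤ} (q : Fin 3) (a b : Multidegree d) : Prop :=
  b.1 = a.1 + twistDegree q

/-- One of the multidegrees is obtained from the other by adding some `multideg 𝒪_(X_q)`. -/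
def Adjacent {d : ℤ} (a b : Multidegree d) : Prop :=
  ∃ q, IsShift q a b ∨ IsShift q b a

theorem IsShift.adjacent {d : ℤ} {q : Fin 3} {a b : Multidegree d} (h : IsShift q a b) :
    Adjacent a b := ⟨q, Or.inl h⟩

theorem IsShift.adjacent' {d : ℤ} {q : Fin 3} {a b : Multidegree d} (h : IsShift q a b) :
    Adjacent b a := ⟨q, Or.inr h⟩

/-- Two different shifts compose to the inverse of the third. -/
theorem IsShift.adjacent_comp {d : ℤ} {q₁ q₂ : Fin 3} {a b c : Multidegree d}
    (h₁ : IsShift q₁ a b) (h₂ : IsShift q₂ b c) (hq : q₁ ≠ q₂) : Adjacent a c := by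
  have key : ∀ r₁ r₂ : Fin 3, r₁ ≠ r₂ →
      ∃ q, twistDegree r₁ + twistDegree r₂ + twistDegree q = 0 := by decide
  obtain ⟨q, hq'⟩ := key q₁ q₂ hq
  refine ⟨q, Or.inr ?_⟩
  unfold IsShift at *
  rw [h₂, h₁, add_assoc, add_assoc, ← add_assoc (twistDegree q₁), hq', add_zero]

/-- Sequences of nonnegative multidegrees of total degree `d` in which consecutive members are
adjacent. -/
inductive LinkPath {d : ℤ} : Multidegree d → Multidegree d → Type
  | nil (a : Multidegree d) : LinkPath a a
  | cons {a b c : Multidegree d} (h : Adjacent a b) (p : LinkPath b c) : LinkPath a c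

namespace LinkPath

variable {d : ℤ}

/-- Some step of the path adds `multideg 𝒪_(X_q)`. -/
def UsesUp (q : Fin 3) : {a b : Multidegree d} → LinkPath a b → Prop
  | _, _, nil _ => False
  | _, _, @cons _ a b _ _ p => IsShift q a b ∨ p.UsesUp q

/-- Some step of the path subtracts `multideg 𝒪_(X_q)`. -/
def UsesDown (q : Fin 3) : {a b : Multidegree d} → LinkPath a b → Prop
  | _, _, nil _ => False
  | _, _, @cons _ a b _ _ p => IsShift q b a ∨ p.UsesDown q

/-- The path does not satisfy any of the conditions:
(I) all three of the `multideg 𝒪_(X_q)` are added at some step;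
(II) for some `q`, `multideg 𝒪_(X_q)` is added at some step and subtracted at some step;
(III) `multideg 𝒪_(X_q)` is subtracted at some step for two different values of `q`. -/
def IsAdmissible {a b : Multidegree d} (p : LinkPath a b) : Prop :=
  ¬ (∀ q, p.UsesUp q) ∧ ¬ (∃ q, p.UsesUp q ∧ p.UsesDown q) ∧
    ¬ (∃ q₁ q₂, q₁ ≠ q₂ ∧ p.UsesDown q₁ ∧ p.UsesDown q₂)

/-- Concatenation of paths. -/
def append {a b c : Multidegree d} : LinkPath a b → LinkPath b c → LinkPath a c
  | nil _, p' => p'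
  | cons h p, p' => cons h (p.append p')

theorem usesUp_append (q : Fin 3) {a b c : Multidegree d} (p : LinkPath a b)
    (p' : LinkPath b c) : (p.append p').UsesUp q ↔ p.UsesUp q ∨ p'.UsesUp q := by
  induction p with
  | nil a => simp [append, UsesUp]
  | cons h p ih => simp [append, UsesUp, ih, or_assoc]

theorem usesDown_append (q : Fin 3) {a b c : Multidegree d} (p : LinkPath a b)
    (p' : LinkPath b c) : (p.append p').UsesDown q ↔ p.UsesDown q ∨ p'.UsesDown q := by
  induction p with
  | nil a => simp [append, UsesDown]
  | cons h p ih => simp [append, UsesDown, ih, or_assoc]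

theorem exists_up (q : Fin 3) (n : ℕ) (a b : Multidegree d)
    (h : ∀ j, b.1 j = a.1 j + n * twistDegree q j) :
    ∃ p : LinkPath a b, (∀ q', p.UsesUp q' → q' = q) ∧ ∀ q', ¬ p.UsesDown q' := by
  induction n generalizing a with
  | zero =>
    obtain rfl : a = b := Subtype.ext (funext fun j => by simpa using (h j).symm)
    exact ⟨nil _, fun q' h => h.elim, fun q' h => h⟩
  | succ n ih =>
    have ht : twistDegree q 0 + twistDegree q 1 + twistDegree q 2 = 0 := by
      clear * -
      revert q
      decide
    let m : Multidegree d := ⟨a.1 + twistDegree q, fun j => by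
      have h1 := a.2.1 j
      have h2 := b.2.1 j
      have h3 := h j
      push_cast at h3
      simp only [Pi.add_apply]
      rcases le_total 0 (twistDegree q j) with h4 | h4
      · linarith
      · nlinarith, by
      have := a.2.2
      simp only [Pi.add_apply]
      linarith⟩
    have hm : IsShift q a m := rfl
    obtain ⟨p, hp, hp'⟩ := ih m fun j => by
      have h3 := h j
      push_cast at h3
      simp only [m, Pi.add_apply]
      linarith
    refine ⟨cons hm.adjacent p, ?_, ?_⟩
    · rintro q' (h' | h')
      · have : twistDegree q = twistDegree q' := by
          have h5 : a.1 + twistDegree q = a.1 + twistDegree q' := h'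
          exact add_left_cancel h5
        clear * - this
        revert q q'
        decide
      · exact hp q' h'
    · rintro q' (h' | h')
      · have : twistDegree q + twistDegree q' = 0 := by
          have h5 : a.1 = a.1 + twistDegree q + twistDegree q' := h'
          rw [add_assoc] at h5
          exact (left_eq_add.mp h5)
        clear * - this
        revert q q'
        decide
      · exact hp' q' h'

theorem exists_down (q : Fin 3) (n : ℕ) (a b : Multidegree d)
    (h : ∀ j, a.1 j = b.1 j + n * twistDegree q j) :
    ∃ p : LinkPath a b, (∀ q', p.UsesDown q' → q' = q) ∧ ∀ q', ¬ p.UsesUp q' := by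
  induction n generalizing a with
  | zero =>
    obtain rfl : a = b := Subtype.ext (funext fun j => by simpa using h j)
    exact ⟨nil _, fun q' h => h.elim, fun q' h => h⟩
  | succ n ih =>
    have ht : twistDegree q 0 + twistDegree q 1 + twistDegree q 2 = 0 := by
      clear * -
      revert q
      decide
    let m : Multidegree d := ⟨a.1 - twistDegree q, fun j => by
      have h1 := a.2.1 j
      have h2 := b.2.1 j
      have h3 := h j
      push_cast at h3
      simp only [Pi.sub_apply]
      rcases le_total 0 (twistDegree q j) with h4 | h4
      · nlinarith
      · linarith, by
      have := a.2.2
      simp only [Pi.sub_apply]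
      linarith⟩
    have hm : IsShift q m a := by simp [IsShift, m]
    obtain ⟨p, hp, hp'⟩ := ih m fun j => by
      have h3 := h j
      push_cast at h3
      simp only [m, Pi.sub_apply]
      linarith
    refine ⟨cons hm.adjacent' p, ?_, ?_⟩
    · rintro q' (h' | h')
      · have : twistDegree q = twistDegree q' := by
          have h5 : m.1 + twistDegree q = m.1 + twistDegree q' := hm.symm.trans h'
          exact add_left_cancel h5
        clear * - this
        revert q q'
        decide
      · exact hp q' h'
    · rintro q' (h' | h')
      · have : twistDegree q + twistDegree q' = 0 := by
          have h5 : m.1 = a.1 + twistDegree q' := h'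
          have h6 : a.1 = m.1 + twistDegree q := hm
          rw [h6, add_assoc] at h5
          exact (left_eq_add.mp h5)
        clear * - this
        revert q q'
        decide
      · exact hp' q' h'

theorem exists_up_up (q₁ q₂ : Fin 3) (n₁ n₂ : ℕ) (a m b : Multidegree d)
    (h₁ : ∀ j, m.1 j = a.1 j + n₁ * twistDegree q₁ j)
    (h₂ : ∀ j, b.1 j = m.1 j + n₂ * twistDegree q₂ j) :
    ∃ p : LinkPath a b, p.IsAdmissible := by
  obtain ⟨p, hp, hp'⟩ := exists_up q₁ n₁ a m h₁
  obtain ⟨p₂, hp₂, hp₂'⟩ := exists_up q₂ n₂ m b h₂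
  refine ⟨p.append p₂, ?_⟩
  simp only [IsAdmissible, usesUp_append, usesDown_append, hp', hp₂', or_self, and_false,
    exists_false, not_false_eq_true, and_true]
  intro h
  have h' : ∀ q, q = q₁ ∨ q = q₂ := fun q => (h q).imp (hp q) (hp₂ q)
  clear * - h'
  revert q₁ q₂
  decide

theorem exists_up_down (q₁ q₂ : Fin 3) (hq : q₁ ≠ q₂) (n₁ n₂ : ℕ) (a m b : Multidegree d)
    (h₁ : ∀ j, m.1 j = a.1 j + n₁ * twistDegree q₁ j)
    (h₂ : ∀ j, m.1 j = b.1 j + n₂ * twistDegree q₂ j) :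
    ∃ p : LinkPath a b, p.IsAdmissible := by
  obtain ⟨p, hp, hp'⟩ := exists_up q₁ n₁ a m h₁
  obtain ⟨p₂, hp₂, hp₂'⟩ := exists_down q₂ n₂ m b h₂
  refine ⟨p.append p₂, ?_⟩
  simp only [IsAdmissible, usesUp_append, usesDown_append, hp', hp₂', or_false, false_or]
  refine ⟨fun h => hq ?_, ?_, ?_⟩
  · have h' : q₁ + 1 = q₁ := hp _ (h (q₁ + 1))
    exfalso
    clear * - h'
    revert q₁
    decide
  · rintro ⟨q, h, h'⟩
    exact hq ((hp q h).symm.trans (hp₂ q h'))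
  · rintro ⟨q, q', h, h', h''⟩
    exact h ((hp₂ q h').trans (hp₂ q' h'').symm)

/-- Any two nonnegative multidegrees are connected by a path not satisfying any of the
conditions (I), (II), (III). -/
theorem exists_isAdmissible (a b : Multidegree d) : ∃ p : LinkPath a b, p.IsAdmissible := by
  have ha := a.2.2
  have hb := b.2.2
  have ha0 := a.2.1 0
  have ha1 := a.2.1 1
  have ha2 := a.2.1 2
  have hb0 := b.2.1 0
  have hb1 := b.2.1 1
  have hb2 := b.2.1 2
  rcases le_total (b.1 0) (a.1 0) with hi | hi
  · let m : Multidegree d := ⟨![b.1 0, d - b.1 0 - a.1 2, a.1 2], fun q => by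
      fin_cases q <;> simp <;> omega, by simp; omega⟩
    obtain ⟨n, hn⟩ := Int.eq_ofNat_of_zero_le (sub_nonneg.2 hi)
    have h₁ : ∀ j, m.1 j = a.1 j + n * twistDegree 0 j := fun j => by
      fin_cases j <;> simp [m, twistDegree] <;> omega
    rcases le_total (b.1 2) (a.1 2) with hl | hl
    · obtain ⟨n', hn'⟩ := Int.eq_ofNat_of_zero_le (sub_nonneg.2 hl)
      exact exists_up_up 0 2 n n' a m b h₁ fun j => by
        fin_cases j <;> simp [m, twistDegree] <;> omega
    · obtain ⟨n', hn'⟩ := Int.eq_ofNat_of_zero_le (sub_nonneg.2 hl)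
      exact exists_up_down 0 2 (by decide) n n' a m b h₁ fun j => by
        fin_cases j <;> simp [m, twistDegree] <;> omega
  · rcases le_total (b.1 2) (a.1 2) with hl | hl
    · let m : Multidegree d := ⟨![a.1 0, d - a.1 0 - b.1 2, b.1 2], fun q => by
        fin_cases q <;> simp <;> omega, by simp; omega⟩
      obtain ⟨n, hn⟩ := Int.eq_ofNat_of_zero_le (sub_nonneg.2 hl)
      obtain ⟨n', hn'⟩ := Int.eq_ofNat_of_zero_le (sub_nonneg.2 hi)
      refine exists_up_down 2 0 (by decide) n n' a m b (fun j => ?_) fun j => ?_ <;>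
        fin_cases j <;> simp [m, twistDegree] <;> omega
    · obtain ⟨n, hn⟩ := Int.eq_ofNat_of_zero_le (sub_nonneg.2 hi)
      obtain ⟨n', hn'⟩ := Int.eq_ofNat_of_zero_le (sub_nonneg.2 hl)
      rcases le_total n n' with hle | hle
      · obtain ⟨c, rfl⟩ := Nat.exists_eq_add_of_le hle
        let m : Multidegree d := ⟨![b.1 0, a.1 1 - 2 * n, a.1 2 + n], fun q => by
          fin_cases q <;> simp <;> omega, by simp; omega⟩
        refine exists_up_down 1 2 (by decide) n c a m b (fun j => ?_) fun j => ?_ <;>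
          fin_cases j <;> simp [m, twistDegree] <;> omega
      · obtain ⟨c, rfl⟩ := Nat.exists_eq_add_of_le hle
        let m : Multidegree d := ⟨![a.1 0 + n', a.1 1 - 2 * n', b.1 2], fun q => by
          fin_cases q <;> simp <;> omega, by simp; omega⟩
        refine exists_up_down 1 0 (by decide) n' c a m b (fun j => ?_) fun j => ?_ <;>
          fin_cases j <;> simp [m, twistDegree] <;> omega

end LinkPath

/-! ### Limit linear series -/

section Series

variable {k : Type u} [Field k] {C : ThreeComponentCurve k}

/-- The sheaf `ℒ_(i, d-i-l, l) = ℒ ⊗ 𝒪_(X₁)^{⊗ (d-i)} ⊗ 𝒪_(-X₃)^{⊗ l}`, where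
`𝒪_(-X₃) = 𝒪_(X₁) ⊗ 𝒪_(X₂)`. -/
def twisted (O : TwistingSheaves C) (L : C.X.Modules) {d : ℤ} (a : Multidegree d) :
    C.X.Modules :=
  tensor (tensor L (tensorPow (O.T 0) (d - a.1 0).toNat))
    (tensorPow (tensor (O.T 0) (O.T 1)) (a.1 2).toNat)

/-- For closed subsets `Y`, `Y'` of `X`, with their reduced structures, the morphism
`φ : M ⟶ N` factors as the restriction map `M ⟶ M|_Y`, followed by an isomorphism from `M|_Y` to
the subsheaf of `N` of the sections vanishing on `Y'`, followed by the inclusion of the latter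
in `N`. When `Y' = Y^c`, or `Y = Y'^c`, and `N` is invertible, this subsheaf is
`N|_Y(-Y ∩ Y')`. -/
def FactorsThrough (C : ThreeComponentCurve k) (Y Y' : Closeds C.X) {M N : C.X.Modules}
    (φ : M ⟶ N) : Prop :=
  ∃ e : restrictTo (C.reducedIdeal Y) M ≅ vanishingSubsheaf (C.reducedIdeal Y') N,
    φ = restrictionMap (C.reducedIdeal Y) M ≫ e.hom ≫ vanishingSubsheafι (C.reducedIdeal Y') N

/-- A system of maps `φ_{a,b} : ℒ_a ⟶ ℒ_b` linking the sheaves of adjacent multidegrees. -/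
structure LinkingMaps (O : TwistingSheaves C) (L : C.X.Modules) (d : ℤ) where
  φ : ∀ {a b : Multidegree d}, Adjacent a b → (twisted O L a ⟶ twisted O L b)
  factor_up : ∀ (q : Fin 3) {a b : Multidegree d} (h : IsShift q a b),
    FactorsThrough C (C.compl (C.comp q)) (C.comp q) (φ h.adjacent)
  factor_down : ∀ (q : Fin 3) {a b : Multidegree d} (h : IsShift q a b),
    FactorsThrough C (C.comp q) (C.compl (C.comp q)) (φ h.adjacent')
  comp_eq : ∀ {q₁ q₂ : Fin 3} {a b c : Multidegree d}
    (h₁ : IsShift q₁ a b) (h₂ : IsShift q₂ b c) (hq : q₁ ≠ q₂),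
    φ h₁.adjacent ≫ φ h₂.adjacent = φ (h₁.adjacent_comp h₂ hq)

/-- The composition of the linking maps along a path. -/
def LinkingMaps.along {O : TwistingSheaves C} {L : C.X.Modules} {d : ℤ}
    (Φ : LinkingMaps O L d) :
    {a b : Multidegree d} → LinkPath a b → (twisted O L a ⟶ twisted O L b)
  | _, _, .nil a => 𝟙 (twisted O L a)
  | _, _, .cons h p => Φ.φ h ≫ Φ.along p

/-- The map `φ_{a,b} : ℒ_a ⟶ ℒ_b` for arbitrary nonnegative multidegrees `a`, `b`: the identity
when `a = b`, and otherwise the composition of the linking maps along a path from `a` to `b` that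
does not satisfy any of the conditions (I), (II), (III). (All such paths give the same
composition.) -/
def LinkingMaps.total {O : TwistingSheaves C} {L : C.X.Modules} {d : ℤ}
    (Φ : LinkingMaps O L d) (a b : Multidegree d) : twisted O L a ⟶ twisted O L b :=
  open Classical in
  if h : a = b then eqToHom (by rw [h])
  else Φ.along (LinkPath.exists_isAdmissible a b).choose

/-- For a subspace `V` of `H⁰(X, M)` and a closed subset `Y` with its reduced structure, the
subspace `V^{Y,0}` of the sections in `V` that vanish on `Y`. -/
def vanishingOn (C : ThreeComponentCurve k) {M : C.X.Modules} (V : Submodule k (H0 C.str M))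
    (Y : Closeds C.X) : Submodule k (H0 C.str M) :=
  V ⊓ LinearMap.ker (H0.map C.str (restrictionMap (C.reducedIdeal Y) M))

/-- A limit linear series of degree `d` and dimension `r` on `X`, together with
the linking maps that it refers to. -/
structure LimitLinearSeries (O : TwistingSheaves C) (d r : ℤ) where
  /-- the invertible sheaf `ℒ` -/
  L : C.X.Modules
  invertible : IsInvertible L
  degree₁ : HasDegree (C.componentι 0 ≫ C.str) (C.res 0 L) d
  degree₂ : HasDegree (C.componentι 1 ≫ C.str) (C.res 1 L) 0
  degree₃ : HasDegree (C.componentι 2 ≫ C.str) (C.res 2 L) 0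
  /-- the linking maps between the sheaves `ℒ_a` -/
  Φ : LinkingMaps O L d
  /-- the spaces of sections `V_a ⊆ H⁰(X, ℒ_a)` -/
  V : ∀ a : Multidegree d, Submodule k (H0 C.str (twisted O L a))
  finite : ∀ a, Module.Finite k (V a)
  dim : ∀ a, (Module.finrank k (V a) : ℤ) = r + 1
  /-- the linking condition -/
  linked : ∀ {a b : Multidegree d} (h : Adjacent a b), (V a).map (H0.map C.str (Φ.φ h)) ≤ V b

namespace LimitLinearSeries

variable {O : TwistingSheaves C} {d r : ℤ}

/-- `g` is exact: for all nonnegative `a` and `b = a + multideg 𝒪_(X_q)`,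
`φ_{a,b}(V_a) = V_b^{X_q,0}` and `φ_{b,a}(V_b) = V_a^{X_q^c,0}`. -/
def IsExact (g : LimitLinearSeries O d r) : Prop :=
  ∀ (q : Fin 3) {a b : Multidegree d} (h : IsShift q a b),
    (g.V a).map (H0.map C.str (g.Φ.φ h.adjacent)) = vanishingOn C (g.V b) (C.comp q) ∧
    (g.V b).map (H0.map C.str (g.Φ.φ h.adjacent')) =
      vanishingOn C (g.V a) (C.compl (C.comp q))

/-- `g` is simple: there are multidegrees `D α` and linearly independent sections
`s α 1, …, s α (n α)` in `V_{D α}` whose images in `V_a` form a basis of `V_a`, for each `a`. -/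
def IsSimple (g : LimitLinearSeries O d r) : Prop :=
  ∃ (m : ℕ) (D : Fin m → Multidegree d) (n : Fin m → ℕ)
    (s : ∀ α, Fin (n α) → H0 C.str (twisted O g.L (D α))),
    (∀ α j, s α j ∈ g.V (D α)) ∧
    (∀ α, LinearIndependent k (s α)) ∧
    ∀ a : Multidegree d,
      LinearIndependent k
        (fun x : Σ α, Fin (n α) => H0.map C.str (g.Φ.total (D x.1) a) (s x.1 x.2)) ∧
      Submodule.span k (Set.range
        (fun x : Σ α, Fin (n α) => H0.map C.str (g.Φ.total (D x.1) a) (s x.1 x.2))) = g.V a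

end LimitLinearSeries

end Series

end LimitSeries

end

namespace LimitSeries

/-! ### Heights of multidegrees -/

section Heights

variable {d : ℤ}

/-! For `b = a + m_q`, the factorizations of the two linking maps say that each one kills exactly
the sections vanishing on the component, or complement, on which the image of the other vanishes. So
the composite `V_a → V_b → V_a` is zero, and exactness asks that the kernel of either map be
contained in the image of the other.

Simplicity provides bases of `V_a` and `V_b` transported from common sections. By `total_comp_or`,
corresponding basis vectors are always related by one of the two linking maps. A combination of
basis vectors of `V_b` killed by the map back can then involve only those coming from `V_a`
(`inf_ker_le_map_of_family`); the other equality is symmetric.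

The dichotomy is combinatorial. Since `m₁ + m₂ + m₃ = 0`, subtracting `m_q` amounts to adding the
other two, so an admissible path stays in the cone spanned by the `m_j` with `j ≠ q`, for some `q`.
Composites in a cone depend only on the endpoints (`ConeComp.unique`), even across cones
(`ConeComp.unique'`), so a transport map followed by a linking map is again a transport map whenever
the composite stays in a cone. -/

theorem IsShift.coord {q : Fin 3} {a b : Multidegree d} (h : IsShift q a b) (j : Fin 3) :
    b.1 j = a.1 j + twistDegree q j := congrFun h j

theorem IsShift.right_unique {q : Fin 3} {a b c : Multidegree d} (h : IsShift q a b)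
    (h' : IsShift q a c) : b = c := Subtype.ext (h.trans h'.symm)

theorem IsShift.left_unique {q : Fin 3} {a b c : Multidegree d} (h : IsShift q b a)
    (h' : IsShift q c a) : b = c := Subtype.ext (add_right_cancel (h.symm.trans h'))

/-- The coefficients of a multidegree with respect to `m₁, m₂, m₃`, up to the relation
`m₁ + m₂ + m₃ = 0` and a common translation. -/
def height (a : Multidegree d) : Fin 3 → ℤ := ![-a.1 0, 0, -a.1 2]

/-- Only differences between two coordinates carry information: adding `m₂` lowers both outer
heights instead of raising the middle one, which is normalized to zero. -/
theorem IsShift.height_sub {q : Fin 3} {a b : Multidegree d} (h : IsShift q a b) (j k : Fin 3) :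
    (height b j - height a j) - (height b k - height a k)
      = (if j = q then 1 else 0) - (if k = q then 1 else 0) := by
  have h0 := h.coord 0
  have h2 := h.coord 2
  fin_cases q <;> fin_cases j <;> fin_cases k <;>
    simp [height, twistDegree] at h0 h2 ⊢ <;> omega

/-- For an end component, `m_q` lowers the degree on that component only, and by one, so a single
inequality keeps the result nonnegative. -/
theorem exists_isShift {q : Fin 3} (hq : q ≠ 1) {a : Multidegree d} (ha : 1 ≤ a.1 q) :
    ∃ b, IsShift q a b := by
  have h := a.2.2
  have h0 := a.2.1 0
  have h1 := a.2.1 1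
  have h2 := a.2.1 2
  refine ⟨⟨a.1 + twistDegree q, fun j => ?_, ?_⟩, rfl⟩
  · fin_cases q <;> fin_cases j <;> simp [twistDegree] at ha hq ⊢ <;> omega
  · fin_cases q <;> simp [twistDegree] at ha hq ⊢ <;> omega

theorem IsShift.of_isShift_isShift {q₁ q₂ q₃ : Fin 3} (h₁₂ : q₁ ≠ q₂) (h₁₃ : q₁ ≠ q₃)
    (h₂₃ : q₂ ≠ q₃) {a b c : Multidegree d} (h : IsShift q₁ a b) (h' : IsShift q₃ c a) :
    IsShift q₂ b c := by
  have key : ∀ r₁ r₂ r₃ : Fin 3, r₁ ≠ r₂ → r₁ ≠ r₃ → r₂ ≠ r₃ →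
      twistDegree r₃ + (twistDegree r₁ + twistDegree r₂) = 0 := by decide
  unfold IsShift at *
  rw [h, h', add_assoc, add_assoc, key _ _ _ h₁₂ h₁₃ h₂₃, add_zero]

theorem IsShift.swap {q₁ q₂ : Fin 3} {a b c e : Multidegree d} (h : IsShift q₁ a b)
    (h' : IsShift q₂ b c) (h'' : IsShift q₂ a e) : IsShift q₁ e c := by
  unfold IsShift at *
  rw [h', h, h'', add_right_comm]

end Heights

/-! ### Composites of linking maps within a cone -/

section Cones

variable {k : Type u} [Field k] {C : ThreeComponentCurve k} {O : TwistingSheaves C}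
  {L : C.X.Modules} {d : ℤ} {Φ : LinkingMaps O L d}

/-- The composites of linking maps along steps that add `m_j` with `j ≠ q`, or subtract `m_q`. -/
inductive ConeComp (Φ : LinkingMaps O L d) (q : Fin 3) :
    {a b : Multidegree d} → (twisted O L a ⟶ twisted O L b) → Prop
  | nil (a : Multidegree d) : ConeComp Φ q (𝟙 (twisted O L a))
  | up {a b c : Multidegree d} {j : Fin 3} (hj : j ≠ q) (h : IsShift j a b)
      {f : twisted O L b ⟶ twisted O L c} (hf : ConeComp Φ q f) :
      ConeComp Φ q (Φ.φ h.adjacent ≫ f)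
  | down {a b c : Multidegree d} (h : IsShift q b a)
      {f : twisted O L b ⟶ twisted O L c} (hf : ConeComp Φ q f) :
      ConeComp Φ q (Φ.φ h.adjacent' ≫ f)

namespace ConeComp

variable {q : Fin 3} {a b c : Multidegree d} {f : twisted O L a ⟶ twisted O L b}

theorem comp (hf : ConeComp Φ q f) {g : twisted O L b ⟶ twisted O L c} (hg : ConeComp Φ q g) :
    ConeComp Φ q (f ≫ g) := by
  induction hf with
  | nil a => simpa using hg
  | up hj h _ ih => simpa using (ih hg).up hj h
  | down h _ ih => simpa using (ih hg).down h

theorem comp_up (hf : ConeComp Φ q f) {j : Fin 3} (hj : j ≠ q) (h : IsShift j b c) :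
    ConeComp Φ q (f ≫ Φ.φ h.adjacent) := by
  simpa using hf.comp ((nil c).up hj h)

theorem comp_down (hf : ConeComp Φ q f) (h : IsShift q c b) :
    ConeComp Φ q (f ≫ Φ.φ h.adjacent') := by
  simpa using hf.comp ((nil c).down h)

/-- No step raises the height at `q` relative to the others, so `q` records a minimum of the height
change. This is what identifies the cone from the endpoints. -/
theorem height_le (hf : ConeComp Φ q f) (j : Fin 3) :
    height b q - height a q ≤ height b j - height a j := by
  induction hf with
  | nil a => simp
  | up hj h _ ih =>
    have := h.height_sub j q
    rw [if_neg hj.symm] at this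
    split_ifs at this <;> omega
  | down h _ ih =>
    have := h.height_sub j q
    split_ifs at this <;> omega

/-- On a common wall of the two cones, a step adding `m_{q'}` or subtracting `m_q` would make the
change at `q'` strictly larger than at `q`, and no later step undoes this. Only the third twist is
added, which both cones allow. -/
theorem switch (hf : ConeComp Φ q f) {q' : Fin 3}
    (hq' : height b q' - height a q' ≤ height b q - height a q) : ConeComp Φ q' f := by
  by_cases hqq : q' = q
  · exact hqq ▸ hf
  induction hf with
  | nil a => exact nil a
  | up hj h hf ih =>
    have h1 := h.height_sub q' q
    have h2 := hf.height_le q'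
    rw [if_neg hj.symm] at h1
    split_ifs at h1 with h3
    · omega
    · exact (ih (by omega)).up (Ne.symm h3) h
  | down h hf ih =>
    have h1 := h.height_sub q' q
    have h2 := hf.height_le q'
    rw [if_neg hqq, if_pos rfl] at h1
    omega

/-- A step `m_{q₁}` that must occur can be moved to the front: it commutes with `m_{q₂}`, and it
splits off from `-m_q = m_{q₁} + m_{q₂}`. Nonnegativity at the start makes the new intermediate
multidegree legitimate. -/
theorem exists_up {q₁ q₂ : Fin 3} (h₁ : q₁ ≠ 1) (h₁₂ : q₁ ≠ q₂) (h₁q : q₁ ≠ q) (h₂q : q₂ ≠ q)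
    (hf : ConeComp Φ q f) (hlt : height b q - height a q < height b q₁ - height a q₁)
    (ha : 1 ≤ a.1 q₁) :
    ∃ (c : Multidegree d) (h : IsShift q₁ a c) (r : twisted O L c ⟶ twisted O L b),
      ConeComp Φ q r ∧ f = Φ.φ h.adjacent ≫ r := by
  induction hf with
  | nil a => simp at hlt
  | @up a e b j hj h f hf ih =>
    by_cases hj₁ : j = q₁
    · subst hj₁
      exact ⟨_, h, _, hf, rfl⟩
    obtain rfl : j = q₂ := by
      clear * - h₁₂ h₁q h₂q hj hj₁
      revert j q₁ q₂ q
      decide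
    have h4 := h.height_sub q₁ q
    rw [if_neg hj.symm, if_neg (Ne.symm hj₁)] at h4
    have h5 : a.1 q₁ ≤ e.1 q₁ := by
      have : ∀ i j : Fin 3, i ≠ 1 → i ≠ j → 0 ≤ twistDegree j i := by decide
      have := this q₁ j h₁ h₁₂
      have := h.coord q₁
      omega
    obtain ⟨c', h', r, hr, rfl⟩ := ih (by omega) (ha.trans h5)
    obtain ⟨c, hc⟩ := exists_isShift h₁ ha
    have hcc := h.swap h' hc
    refine ⟨c, hc, _, hr.up h₂q hcc, ?_⟩
    -- Both orders of the two steps equal the single linking map that subtracts `m_q`.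
    rw [← Category.assoc, ← Category.assoc, Φ.comp_eq h h' h₁₂.symm, Φ.comp_eq hc hcc h₁₂]
  | @down a e b h f hf ih =>
    obtain ⟨c, hc⟩ := exists_isShift h₁ ha
    have hce := hc.of_isShift_isShift h₁₂ h₁q h₂q h
    refine ⟨c, hc, _, hf.up h₂q hce, ?_⟩
    rw [← Category.assoc, Φ.comp_eq hc hce h₁₂]

/-- When degree zero on `X_{q₁}` blocks `m_{q₁}`, an initial `m_{q₂}` can only be the middle twist,
which makes room for `m_{q₁}`. The latter is then pulled forward and merged with `m_{q₂}` into
`-m_q`. -/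
theorem exists_down {q₁ q₂ : Fin 3} (h₁ : q₁ ≠ 1) (h₁₂ : q₁ ≠ q₂) (h₁q : q₁ ≠ q) (h₂q : q₂ ≠ q)
    (hf : ConeComp Φ q f) (hlt : height b q - height a q < height b q₁ - height a q₁)
    (ha : ¬ 1 ≤ a.1 q₁) :
    ∃ (c : Multidegree d) (h : IsShift q c a) (r : twisted O L c ⟶ twisted O L b),
      ConeComp Φ q r ∧ f = Φ.φ h.adjacent' ≫ r := by
  cases hf with
  | nil a => simp at hlt
  | @up a e b j hj h f hf =>
    have h3 := h.coord q₁
    have h6 := e.2.1 q₁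
    have h7 := b.2.1 q₁
    by_cases hj₁ : j = q₁
    · subst hj₁
      have : ∀ i : Fin 3, i ≠ 1 → twistDegree i i = -1 := by decide
      rw [this j h₁] at h3
      omega
    obtain rfl : j = q₂ := by
      clear * - h₁₂ h₁q h₂q hj hj₁
      revert j q₁ q₂ q
      decide
    have h4 := h.height_sub q₁ q
    rw [if_neg hj.symm, if_neg (Ne.symm hj₁)] at h4
    have h5 : 1 ≤ e.1 q₁ := by
      by_cases hj' : j = 1
      · subst hj'
        have : ∀ i : Fin 3, i ≠ 1 → twistDegree 1 i = 1 := by decide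
        rw [this q₁ h₁] at h3
        have := a.2.1 q₁
        omega
      -- If `q` is the middle index, a larger height change at `q₁` than at `q` means that the
      -- degree on `X_{q₁}` drops, which is impossible from zero.
      · exfalso
        obtain rfl : q = 1 := by
          clear * - h₁₂ h₁q h₂q h₁ hj'
          revert j q₁ q
          decide
        have : ∀ x : Multidegree d, height x q₁ - height x 1 = - x.1 q₁ := fun x => by
          clear * - h₁
          fin_cases q₁ <;> simp [height] at h₁ ⊢
        have h8 := this a
        have h9 := this b
        omega
    obtain ⟨c, h', r, hr, rfl⟩ := hf.exists_up h₁ h₁₂ h₁q h₂q (by omega) h5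
    have hca : IsShift q c a := by
      have key : ∀ r₁ r₂ r₃ : Fin 3, r₁ ≠ r₂ → r₁ ≠ r₃ → r₂ ≠ r₃ →
        twistDegree r₂ + (twistDegree r₁ + twistDegree r₃) = 0 := by decide
      unfold IsShift at *
      rw [h', h, add_assoc, add_assoc, key _ _ _ h₁₂ h₁q h₂q, add_zero]
    refine ⟨c, hca, r, hr, ?_⟩
    rw [← Category.assoc, Φ.comp_eq h h' h₁₂.symm]
  | @down a e b h f hf => exact ⟨_, h, _, hf, rfl⟩

theorem exists_up_of_height_eq {q₁ q₂ : Fin 3} (h₁₂ : q₁ ≠ q₂) (h₁q : q₁ ≠ q) (h₂q : q₂ ≠ q)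
    (hf : ConeComp Φ q f) (hle : height b q₁ - height a q₁ ≤ height b q - height a q)
    (hlt : height b q - height a q < height b q₂ - height a q₂) :
    ∃ (c : Multidegree d) (h : IsShift q₂ a c) (r : twisted O L c ⟶ twisted O L b),
      ConeComp Φ q r ∧ f = Φ.φ h.adjacent ≫ r := by
  cases hf with
  | nil a => simp at hlt
  | @up a e b j hj h f hf =>
    have h4 := h.height_sub q₁ q
    have h5 := hf.height_le q₁
    rw [if_neg hj.symm] at h4
    split_ifs at h4 with hj₁
    · omega
    obtain rfl : j = q₂ := by
      clear * - h₁₂ h₁q h₂q hj hj₁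
      revert j q₁ q₂ q
      decide
    exact ⟨_, h, _, hf, rfl⟩
  | @down a e b h f hf =>
    have h4 := h.height_sub q₁ q
    have h5 := hf.height_le q₁
    rw [if_neg h₁q, if_pos rfl] at h4
    omega

/-- The composite depends only on the endpoints. -/
theorem unique (hf : ConeComp Φ q f) {g : twisted O L a ⟶ twisted O L b}
    (hg : ConeComp Φ q g) : f = g := by
  obtain ⟨q₁, q₂, h₁, h₁₂, h₁q, h₂q⟩ :
      ∃ q₁ q₂ : Fin 3, q₁ ≠ 1 ∧ q₁ ≠ q₂ ∧ q₁ ≠ q ∧ q₂ ≠ q := by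
    clear * -
    revert q
    decide
  -- The induction measure is the path length, with a step `-m_q` counted twice.
  obtain ⟨n, hn⟩ := Int.eq_ofNat_of_zero_le (a := (height b q₁ - height a q₁) +
    (height b q₂ - height a q₂) - 2 * (height b q - height a q)) (by
      have := hf.height_le q₁
      have := hf.height_le q₂
      omega)
  induction n using Nat.strong_induction_on generalizing a with
  | _ n ih =>
  have hq₁ := hf.height_le q₁
  have hq₂ := hf.height_le q₂
  have step {c : Multidegree d} {r r' : twisted O L c ⟶ twisted O L b} (hr : ConeComp Φ q r)
      (hr' : ConeComp Φ q r') (hc : (height c q₁ - height a q₁) + (height c q₂ - height a q₂)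
        - 2 * (height c q - height a q) > 0) : r = r' := by
    have := hr.height_le q₁
    have := hr.height_le q₂
    exact ih ((height b q₁ - height c q₁) + (height b q₂ - height c q₂)
      - 2 * (height b q - height c q)).toNat (by omega) hr hr' (by omega)
  by_cases hlt : height b q - height a q < height b q₁ - height a q₁
  · by_cases ha : 1 ≤ a.1 q₁
    · obtain ⟨c, h, r, hr, rfl⟩ := hf.exists_up h₁ h₁₂ h₁q h₂q hlt ha
      obtain ⟨c', h', r', hr', rfl⟩ := hg.exists_up h₁ h₁₂ h₁q h₂q hlt ha
      obtain rfl := h.right_unique h'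
      rw [step hr hr']
      have h1 := h.height_sub q₁ q
      have h2 := h.height_sub q₂ q
      rw [if_neg h₁q.symm] at h1 h2
      rw [if_pos rfl] at h1
      rw [if_neg h₁₂.symm] at h2
      omega
    · obtain ⟨c, h, r, hr, rfl⟩ := hf.exists_down h₁ h₁₂ h₁q h₂q hlt ha
      obtain ⟨c', h', r', hr', rfl⟩ := hg.exists_down h₁ h₁₂ h₁q h₂q hlt ha
      obtain rfl := h.left_unique h'
      rw [step hr hr']
      have h1 := h.height_sub q₁ q
      have h2 := h.height_sub q₂ q
      rw [if_pos rfl] at h1 h2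
      rw [if_neg h₁q] at h1
      rw [if_neg h₂q] at h2
      omega
  by_cases hlt₂ : height b q - height a q < height b q₂ - height a q₂
  · obtain ⟨c, h, r, hr, rfl⟩ := hf.exists_up_of_height_eq h₁₂ h₁q h₂q (by omega) hlt₂
    obtain ⟨c', h', r', hr', rfl⟩ := hg.exists_up_of_height_eq h₁₂ h₁q h₂q (by omega) hlt₂
    obtain rfl := h.right_unique h'
    rw [step hr hr']
    have h1 := h.height_sub q₁ q
    have h2 := h.height_sub q₂ q
    rw [if_neg h₂q.symm] at h1 h2
    rw [if_neg h₁₂] at h1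
    rw [if_pos rfl] at h2
    omega
  -- No height change is left, so the path is empty. Stating this with `eqToHom` lets the case split
  -- proceed while the two endpoints are still distinct variables.
  · have key {f : twisted O L a ⟶ twisted O L b} (hf : ConeComp Φ q f) :
        ∃ h : twisted O L a = twisted O L b, f = eqToHom h := by
      cases hf with
      | nil a => exact ⟨rfl, rfl⟩
      | @up a e b j hj h f hf =>
        have h1 := h.height_sub j q
        have h2 := hf.height_le j
        have h3 : j = q₁ ∨ j = q₂ := by
          clear * - h₁₂ h₁q h₂q hj
          revert j q₁ q₂ q
          decide
        rw [if_pos rfl, if_neg hj.symm] at h1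
        rcases h3 with rfl | rfl <;> omega
      | @down a e b h f hf =>
        have h1 := h.height_sub q₁ q
        have h2 := hf.height_le q₁
        rw [if_pos rfl, if_neg h₁q] at h1
        omega
    obtain ⟨_, rfl⟩ := key hf
    obtain ⟨_, rfl⟩ := key hg
    rfl

theorem unique' (hf : ConeComp Φ q f) {q' : Fin 3} {g : twisted O L a ⟶ twisted O L b}
    (hg : ConeComp Φ q' g) : f = g :=
  (hf.switch (hg.height_le q)).unique hg

end ConeComp

theorem coneComp_along {q : Fin 3} {a b : Multidegree d} (p : LinkPath a b)
    (hup : ¬ p.UsesUp q) (hdown : ∀ j, p.UsesDown j → j = q) : ConeComp Φ q (Φ.along p) := by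
  induction p with
  | nil a => exact .nil a
  | @cons a b c h p ih =>
    have hp := ih (fun h' => hup (Or.inr h')) (fun j h' => hdown j (Or.inr h'))
    obtain ⟨j, hj | hj⟩ := h
    · refine hp.up (j := j) ?_ hj
      rintro rfl
      exact hup (Or.inl hj)
    · obtain rfl := hdown j (Or.inl hj)
      exact hp.down hj

/-- If some `m_q` is subtracted, excluding (II) and (III) confines the path to the cone of `q`; if
none is, excluding (I) leaves a twist that is never added. -/
theorem exists_coneComp_total (Φ : LinkingMaps O L d) (a b : Multidegree d) :
    ∃ q, ConeComp Φ q (Φ.total a b) := by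
  unfold LinkingMaps.total
  split_ifs with h
  · subst h
    exact ⟨0, .nil a⟩
  · obtain ⟨h1, h2, h3⟩ := (LinkPath.exists_isAdmissible a b).choose_spec
    generalize (LinkPath.exists_isAdmissible a b).choose = p at *
    by_cases hd : ∃ q, p.UsesDown q
    · obtain ⟨q, hq⟩ := hd
      refine ⟨q, coneComp_along p (fun h => h2 ⟨q, h, hq⟩) fun j hj => ?_⟩
      by_contra hne
      exact h3 ⟨j, q, hne, hj, hq⟩
    · push Not at h1 hd
      obtain ⟨q, hq⟩ := h1
      exact ⟨q, coneComp_along p hq fun j hj => (hd j hj).elim⟩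

/-- For `b = a + m_q`, one of the maps to `ℒ_a` and `ℒ_b` factors through the other. -/
theorem total_comp_or (Φ : LinkingMaps O L d) {q : Fin 3} {a b : Multidegree d}
    (h : IsShift q a b) (e : Multidegree d) :
    Φ.total e b = Φ.total e a ≫ Φ.φ h.adjacent ∨
      Φ.total e a = Φ.total e b ≫ Φ.φ h.adjacent' := by
  obtain ⟨q', hf⟩ := exists_coneComp_total Φ e a
  obtain ⟨q'', hg⟩ := exists_coneComp_total Φ e b
  by_cases hq : ∃ j, q ≠ j ∧ ConeComp Φ j (Φ.total e a)
  · obtain ⟨j, hj, hf'⟩ := hq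
    exact Or.inl (hg.unique' (hf'.comp_up hj h))
  push Not at hq
  obtain rfl : q = q' := by
    by_contra hne
    exact hq q' hne hf
  -- The map to `ℒ_a` now lies in the cone of `q` alone, so the height change has its strict minimum
  -- at `q`. Adding `m_q` raises it by one relative to the others, hence it is still a minimum at
  -- `b`.
  refine Or.inr (hf.unique' (ConeComp.comp_down (hg.switch ?_) h))
  by_cases hqq : q = q''
  · rw [hqq]
  have h1 := h.height_sub q'' q
  rw [if_pos rfl, if_neg (Ne.symm hqq)] at h1
  by_contra hlt
  exact hq q'' hqq (hf.switch (by omega))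

end Cones

/-! ### Sections and linking maps -/

section Sections

variable {k : Type u} [Field k] {X : Scheme.{u}} (f : X ⟶ Spec (CommRingCat.of k))

theorem H0.map_comp {M N P : X.Modules} (φ : M ⟶ N) (ψ : N ⟶ P) :
    H0.map f (φ ≫ ψ) = H0.map f ψ ∘ₗ H0.map f φ := rfl

theorem H0.map_zero (M N : X.Modules) : H0.map f (0 : M ⟶ N) = 0 := rfl

theorem H0.map_injective {M N : X.Modules} (φ : M ⟶ N) [Mono φ] :
    Function.Injective (H0.map f φ) := by
  have : Mono (Scheme.Modules.Hom.app φ ⊤) := by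
    have h1 : Mono ((Scheme.Modules.toPresheaf X).map φ) := inferInstance
    exact (NatTrans.mono_iff_mono_app _).1 h1 (.op ⊤)
  exact (AddCommGrpCat.mono_iff_injective _).1 this

end Sections

/-! ### Kernels and images of linking maps on sections -/

section Factorization

variable {k : Type u} [Field k] {C : ThreeComponentCurve k}

/-- After the restriction, what remains is an isomorphism and a kernel inclusion, which are
injective on global sections. -/
theorem FactorsThrough.ker_map {Y Y' : Closeds C.X} {M N : C.X.Modules} {φ : M ⟶ N}
    (h : FactorsThrough C Y Y' φ) :
    LinearMap.ker (H0.map C.str φ)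
      = LinearMap.ker (H0.map C.str (restrictionMap (C.reducedIdeal Y) M)) := by
  obtain ⟨e, rfl⟩ := h
  have : Mono (vanishingSubsheafι (C.reducedIdeal Y') N) :=
    inferInstanceAs (Mono (kernel.ι (restrictionMap (C.reducedIdeal Y') N)))
  rw [H0.map_comp, LinearMap.ker_comp_of_ker_eq_bot]
  exact LinearMap.ker_eq_bot.2 (H0.map_injective _ _)

theorem FactorsThrough.comp_restrictionMap {Y Y' : Closeds C.X} {M N : C.X.Modules} {φ : M ⟶ N}
    (h : FactorsThrough C Y Y' φ) : φ ≫ restrictionMap (C.reducedIdeal Y') N = 0 := by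
  obtain ⟨e, rfl⟩ := h
  have : vanishingSubsheafι (C.reducedIdeal Y') N ≫ restrictionMap (C.reducedIdeal Y') N = 0 :=
    kernel.condition _
  rw [Category.assoc, Category.assoc, this, comp_zero, comp_zero]

theorem FactorsThrough.range_map_le {Y Y' : Closeds C.X} {M N : C.X.Modules} {φ : M ⟶ N}
    (h : FactorsThrough C Y Y' φ) :
    LinearMap.range (H0.map C.str φ)
      ≤ LinearMap.ker (H0.map C.str (restrictionMap (C.reducedIdeal Y') N)) := by
  rw [LinearMap.range_le_ker_iff, ← H0.map_comp, h.comp_restrictionMap, H0.map_zero]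

end Factorization

/-- Suppose that each member of a basis of `W` is the image under `F` of the corresponding vector
of `V`, or is mapped by `G` to that vector, these vectors being linearly independent.
If `G ∘ F = 0`, then the span of the basis of `W` meets `ker G` inside the image under `F` of the
span of the vectors of `V`. -/
theorem inf_ker_le_map_of_family {k V W ι : Type*} [Field k] [AddCommGroup V] [AddCommGroup W]
    [Module k V] [Module k W] [Fintype ι] {F : V →ₗ[k] W} {G : W →ₗ[k] V} (hGF : G ∘ₗ F = 0)
    {v : ι → V} {w : ι → W} (hv : LinearIndependent k v)
    (h : ∀ i, w i = F (v i) ∨ v i = G (w i)) :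
    Submodule.span k (Set.range w) ⊓ LinearMap.ker G ≤ (Submodule.span k (Set.range v)).map F := by
  classical
  rintro x ⟨hx, hGx⟩
  obtain ⟨c, rfl⟩ := (Submodule.mem_span_range_iff_exists_fun k).1 hx
  -- Applying `G` to the combination kills the terms coming from `V`, as `G ∘ F = 0`, and turns each
  -- remaining `w i` into `v i`; independence then forces the remaining coefficients to vanish.
  have hG : ∑ i, (if w i = F (v i) then 0 else c i) • v i = 0 := by
    rw [← LinearMap.mem_ker.1 hGx, map_sum]
    refine Finset.sum_congr rfl fun i _ => ?_
    split_ifs with hi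
    · rw [map_smul, hi, ← LinearMap.comp_apply, hGF, LinearMap.zero_apply, smul_zero, zero_smul]
    · rw [map_smul, ← (h i).resolve_left hi]
  have hc := Fintype.linearIndependent_iff.1 hv _ hG
  refine ⟨∑ i, c i • v i, (Submodule.mem_span_range_iff_exists_fun k).2 ⟨c, rfl⟩, ?_⟩
  rw [map_sum]
  refine Finset.sum_congr rfl fun i _ => ?_
  rw [map_smul]
  by_cases hi : w i = F (v i)
  · rw [hi]
  · have := hc i
    rw [if_neg hi] at this
    rw [this, zero_smul, zero_smul]

end LimitSeries

/-! ### Simple implies exact -/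

theorem mainTheorem7 {k : Type u} [Field k] (C : LimitSeries.ThreeComponentCurve k)
    (O : LimitSeries.TwistingSheaves C) (d r : ℤ) (g : LimitSeries.LimitLinearSeries O d r)
    (hg : g.IsSimple) : g.IsExact := by
  obtain ⟨m, D, n, s, -, -, hs⟩ := hg
  intro q a b h
  -- Stated symmetrically in the two directions, so that it yields both equalities of exactness.
  have hker {a b : LimitSeries.Multidegree d} {Y Y' : TopologicalSpace.Closeds C.X}
      {h : LimitSeries.Adjacent a b} {h' : LimitSeries.Adjacent b a}
      (hφ : LimitSeries.FactorsThrough C Y Y' (g.Φ.φ h))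
      (hψ : LimitSeries.FactorsThrough C Y' Y (g.Φ.φ h'))
      (hor : ∀ e, g.Φ.total e b = g.Φ.total e a ≫ g.Φ.φ h ∨
        g.Φ.total e a = g.Φ.total e b ≫ g.Φ.φ h') :
      (g.V a).map (LimitSeries.H0.map C.str (g.Φ.φ h))
        = LimitSeries.vanishingOn C (g.V b) Y' := by
    refine le_antisymm (le_inf (g.linked h) (LinearMap.map_le_range.trans hφ.range_map_le)) ?_
    -- Vanishing on `Y'` becomes membership in the kernel of the opposite linking map.
    rw [LimitSeries.vanishingOn, ← hψ.ker_map, ← (hs a).2, ← (hs b).2]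
    refine LimitSeries.inf_ker_le_map_of_family ?_ (hs a).1 fun x => ?_
    · rw [← LinearMap.range_le_ker_iff, hψ.ker_map]
      exact hφ.range_map_le
    · exact (hor (D x.1)).imp (fun he => by rw [he]; rfl) (fun he => by rw [he]; rfl)
  exact ⟨hker (g.Φ.factor_up q h) (g.Φ.factor_down q h) (LimitSeries.total_comp_or g.Φ h),
    hker (g.Φ.factor_down q h) (g.Φ.factor_up q h)
      fun e => (LimitSeries.total_comp_or g.Φ h e).symm⟩
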